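/- Let $I$ be a nonempty totally ordered set and let $\theta$ be the order type of the ordinal sum $\{0\}+I$. An $\mathrm{LM}_\theta$-algebra is a bounded distributive lattice $A$ with unary operations $\phi_i,\overline{\phi}_i$ ($i\in I$) such that, for all $i,j\in I$ and $x,y\in A$: $\phi_i$ is an endomorphism of bounded lattices; $\phi_i x\vee\overline{\phi}_i x=1$ and $\phi_i x\wedge\overline{\phi}_i x=0$; $\phi_i\phi_j x=\phi_j x$; $i\le j$ implies $\phi_i x\le\phi_j x$; and if $\phi_k x=\phi_k y$ for all $k\in I$, then $x=y$. Let $A$ be an $\mathrm{LM}_\theta$-algebra. Its dual space $X(A)$ is the set of prime filters of $A$, ordered by inclusion, with the topology having as a subbasis the sets $\sigma_A(a)=\{P\in X(A): a\in P\}$ and $X(A)\setminus\sigma_A(a)$ ($a\in A$), and with the maps $f_i^A(P)=\phi_i^{-1}(P)$ ($i\in I$). A subset $Y\subseteq X(A)$ is *semimodal* if $\bigcup_{i\in I}f_i^A(Y)\subseteq Y$, and *modal* if $Y=(f_i^A)^{-1}(Y)$ for all $i\in I$. Let $\mathcal{CO}_M(X(A))$ be the Boolean lattice of all closed, open and modal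 subsets of $X(A)$, with the set-theoretic operations. Let $Con_{LM_\theta}(A)$ be the lattice, ordered by inclusion, of all congruences on $A$ (equivalence relations compatible with $\vee,\wedge$ and all $\phi_i,\overline{\phi}_i$), and let $Con_{bLM_\theta}(A)$ be the lattice of Boolean congruences on $A$, that is, of the complemented elements of $Con_{LM_\theta}(A)$. For an open set $G\subseteq X(A)$ with semimodal complement put $\Theta_{OS}(G)=\{(a,b)\in A\times A:\sigma_A(b)\,\triangle\,\sigma_A(a)\subseteq G\}$, and for a closed semimodal set $Y\subseteq X(A)$ put $\Theta_S(Y)=\{(a,b)\in A\times A:\sigma_A(a)\cap Y=\sigma_A(b)\cap Y\}$. Theorem. Every $G\in\mathcal{CO}_M(X(A))$ is in the domain of both $\Theta_{OS}$ and $\Theta_S$, that is, $G$ is open with semimodal complement and is closed and semimodal. The restriction $\Theta_{OM}$ of $\Theta_{OS}$ to $\mathcal{CO}_M(X(A))$ is a lattice isomorphism from $\mathcal{CO}_M(X(A))$ onto $Con_{bLM_\theta}(A)$, and the restriction $\Theta_{CM}$ of $\Theta_S$ to $\mathcal{CO}_M(X(A))$ is a lattice isomorphism from $\mathcal{CO}_M(X(A))$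 onto the dual lattice of $Con_{bLM_\theta}(A)$. -/

import Mathlib

open Set Order

namespace LM

universe u v

/-- A `θ`-valued Łukasiewicz–Moisil algebra structure on a bounded distributive lattice `A`.
Here `θ` is the order type of `{0} + I` (ordinal sum), so that a chain `θ ≥ 2` with least element
is the same thing as a nonempty chain `I`. -/
class LMAlgebra (I : Type u) [LinearOrder I] (A : Type v) [DistribLattice A] [BoundedOrder A] where
  /-- the operations `φ i`, which are endomorphisms of bounded lattices -/
  phi : I → BoundedLatticeHom A A
  /-- the operations `φ̄ i` -/
  phiBar : I → A → A
  phi_sup_phiBar : ∀ i x, phi i x ⊔ phiBar i x = ⊤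
  phi_inf_phiBar : ∀ i x, phi i x ⊓ phiBar i x = ⊥
  phi_phi : ∀ i j x, phi i (phi j x) = phi j x
  phi_mono : ∀ i j x, i ≤ j → phi i x ≤ phi j x
  determination : ∀ x y, (∀ i, phi i x = phi i y) → x = y

open LMAlgebra

section Congruences

/-- A congruence of the `LM_θ`-algebra `A`: an equivalence relation compatible with all the
operations. -/
@[ext]
structure LMCongruence (I : Type u) [LinearOrder I] (A : Type v) [DistribLattice A]
    [BoundedOrder A] [LMAlgebra I A] extends Setoid A where
  sup_compat : ∀ {a b c d : A}, r a b → r c d → r (a ⊔ c) (b ⊔ d)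
  inf_compat : ∀ {a b c d : A}, r a b → r c d → r (a ⊓ c) (b ⊓ d)
  phi_compat : ∀ (i : I) {a b : A}, r a b → r (phi i a) (phi i b)
  phiBar_compat : ∀ (i : I) {a b : A}, r a b → r (phiBar i a) (phiBar i b)

namespace LMCongruence

theorem eqvGen_map {X : Type v} {r s : X → X → Prop} {f : X → X}
    (hf : ∀ x y, r x y → Relation.EqvGen s (f x) (f y)) {a b : X}
    (h : Relation.EqvGen r a b) : Relation.EqvGen s (f a) (f b) := by
  induction h with
  | rel x y h => exact hf x y h
  | refl x => exact .refl _
  | symm x y _ ih => exact .symm _ _ ih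
  | trans x y z _ _ ih1 ih2 => exact .trans _ _ _ ih1 ih2

variable {I : Type u} [LinearOrder I] {A : Type v} [DistribLattice A] [BoundedOrder A]
  [LMAlgebra I A]

/-- The congruence as a set of ordered pairs. -/
def pairs (c : LMCongruence I A) : Set (A × A) := {p | c.toSetoid p.1 p.2}

theorem toSetoid_injective :
    Function.Injective (LMCongruence.toSetoid : LMCongruence I A → Setoid A) := by
  intro c d h
  cases c; cases d; cases h; rfl

/-- Congruences are ordered by inclusion. -/
instance : PartialOrder (LMCongruence I A) :=
  PartialOrder.lift LMCongruence.toSetoid toSetoid_injective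

theorem le_iff_pairs {c d : LMCongruence I A} : c ≤ d ↔ c.pairs ⊆ d.pairs :=
  ⟨fun h _ hp => h hp, fun h a b hab => @h (a, b) hab⟩

/-- The join of two congruences is their join as equivalence relations. -/
instance : Max (LMCongruence I A) where
  max c d :=
    { toSetoid := c.toSetoid ⊔ d.toSetoid
      sup_compat := by
        intro a b x y h1 h2
        rw [Setoid.sup_eq_eqvGen] at *
        refine .trans _ (b ⊔ x) _ (eqvGen_map (f := (· ⊔ x)) ?_ h1)
          (eqvGen_map (f := (b ⊔ ·)) ?_ h2)
        · rintro u w (h | h)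
          · exact .rel _ _ (.inl (c.sup_compat h (c.refl x)))
          · exact .rel _ _ (.inr (d.sup_compat h (d.refl x)))
        · rintro u w (h | h)
          · exact .rel _ _ (.inl (c.sup_compat (c.refl b) h))
          · exact .rel _ _ (.inr (d.sup_compat (d.refl b) h))
      inf_compat := by
        intro a b x y h1 h2
        rw [Setoid.sup_eq_eqvGen] at *
        refine .trans _ (b ⊓ x) _ (eqvGen_map (f := (· ⊓ x)) ?_ h1)
          (eqvGen_map (f := (b ⊓ ·)) ?_ h2)
        · rintro u w (h | h)
          · exact .rel _ _ (.inl (c.inf_compat h (c.refl x)))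
          · exact .rel _ _ (.inr (d.inf_compat h (d.refl x)))
        · rintro u w (h | h)
          · exact .rel _ _ (.inl (c.inf_compat (c.refl b) h))
          · exact .rel _ _ (.inr (d.inf_compat (d.refl b) h))
      phi_compat := by
        intro i a b h
        rw [Setoid.sup_eq_eqvGen] at *
        refine eqvGen_map (f := fun x => phi i x) ?_ h
        rintro u w (h | h)
        · exact .rel _ _ (.inl (c.phi_compat i h))
        · exact .rel _ _ (.inr (d.phi_compat i h))
      phiBar_compat := by
        intro i a b h
        rw [Setoid.sup_eq_eqvGen] at *
        refine eqvGen_map (f := fun x => phiBar i x) ?_ h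
        rintro u w (h | h)
        · exact .rel _ _ (.inl (c.phiBar_compat i h))
        · exact .rel _ _ (.inr (d.phiBar_compat i h)) }

/-- The meet of two congruences is their intersection. -/
instance : Min (LMCongruence I A) where
  min c d :=
    { toSetoid := c.toSetoid ⊓ d.toSetoid
      sup_compat := fun h1 h2 => ⟨c.sup_compat h1.1 h2.1, d.sup_compat h1.2 h2.2⟩
      inf_compat := fun h1 h2 => ⟨c.inf_compat h1.1 h2.1, d.inf_compat h1.2 h2.2⟩
      phi_compat := fun i _ _ h => ⟨c.phi_compat i h.1, d.phi_compat i h.2⟩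
      phiBar_compat := fun i _ _ h => ⟨c.phiBar_compat i h.1, d.phiBar_compat i h.2⟩ }

theorem toSetoid_sup (c d : LMCongruence I A) :
    (c ⊔ d).toSetoid = c.toSetoid ⊔ d.toSetoid := rfl

theorem toSetoid_inf (c d : LMCongruence I A) :
    (c ⊓ d).toSetoid = c.toSetoid ⊓ d.toSetoid := rfl

instance : Lattice (LMCongruence I A) where
  sup := (· ⊔ ·)
  inf := (· ⊓ ·)
  le_sup_left c d := (le_sup_left : c.toSetoid ≤ c.toSetoid ⊔ d.toSetoid)
  le_sup_right c d := (le_sup_right : d.toSetoid ≤ c.toSetoid ⊔ d.toSetoid)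
  sup_le c d e h1 h2 := (sup_le h1 h2 : c.toSetoid ⊔ d.toSetoid ≤ e.toSetoid)
  inf_le_left c d := (inf_le_left : c.toSetoid ⊓ d.toSetoid ≤ c.toSetoid)
  inf_le_right c d := (inf_le_right : c.toSetoid ⊓ d.toSetoid ≤ d.toSetoid)
  le_inf c d e h1 h2 := (le_inf h1 h2 : c.toSetoid ≤ d.toSetoid ⊓ e.toSetoid)

/-- The median term of a distributive lattice. -/
def med (a b x : A) : A := (a ⊓ b) ⊔ ((a ⊓ x) ⊔ (b ⊓ x))

/-- The lattice of congruences is distributive. -/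
instance : DistribLattice (LMCongruence I A) :=
  DistribLattice.ofInfSupLe (fun c d e => by
    intro a b h
    obtain ⟨hc, hde⟩ := h
    have key : ∀ x y : A, (d.toSetoid ⊔ e.toSetoid) x y →
        ((c ⊓ d).toSetoid ⊔ (c ⊓ e).toSetoid) (med a b x) (med a b y) := by
      intro x y hxy
      rw [Setoid.sup_eq_eqvGen] at *
      refine eqvGen_map (f := med a b) ?_ hxy
      have hcm : ∀ u w : A, c.toSetoid (med a b u) (med a b w) := by
        have h1 : ∀ u : A, c.toSetoid (med a b u) a := by
          intro u
          have h := c.sup_compat (c.inf_compat (c.refl a) (c.symm hc))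
            (c.sup_compat (c.refl (a ⊓ u)) (c.inf_compat (c.symm hc) (c.refl u)))
          have e : a ⊓ a ⊔ (a ⊓ u ⊔ a ⊓ u) = a := by simp
          rw [e] at h
          exact h
        exact fun u w => c.trans (h1 u) (c.symm (h1 w))
      rintro u w (h | h)
      · exact .rel _ _ (.inl ⟨hcm u w, d.sup_compat (d.refl _) (d.sup_compat
          (d.inf_compat (d.refl a) h) (d.inf_compat (d.refl b) h))⟩)
      · exact .rel _ _ (.inr ⟨hcm u w, e.sup_compat (e.refl _) (e.sup_compat
          (e.inf_compat (e.refl a) h) (e.inf_compat (e.refl b) h))⟩)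
    have ha : med a b a = a := by
      simp only [med, inf_idem]
      rw [sup_eq_right.2]
      · simp
      · exact le_sup_of_le_left inf_le_left
    have hb : med a b b = b := by
      simp only [med, inf_idem]
      rw [← sup_assoc]
      simp
    have := key a b hde
    rw [ha, hb] at this
    exact this)

instance : BoundedOrder (LMCongruence I A) where
  top :=
    { toSetoid := ⊤
      sup_compat := fun _ _ => trivial
      inf_compat := fun _ _ => trivial
      phi_compat := fun _ _ _ _ => trivial
      phiBar_compat := fun _ _ _ _ => trivial }
  bot :=
    { toSetoid := ⊥
      sup_compat := by rintro _ _ _ _ rfl rfl; rfl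
      inf_compat := by rintro _ _ _ _ rfl rfl; rfl
      phi_compat := by rintro _ _ _ rfl; rfl
      phiBar_compat := by rintro _ _ _ rfl; rfl }
  le_top c := (le_top : c.toSetoid ≤ ⊤)
  bot_le c := (bot_le : ⊥ ≤ c.toSetoid)

end LMCongruence

/-- The lattice of Boolean congruences: the complemented elements of the lattice of congruences,
with the operations of that lattice. -/
abbrev BooleanCongruence (I : Type u) [LinearOrder I] (A : Type v) [DistribLattice A]
    [BoundedOrder A] [LMAlgebra I A] : Type v :=
  Complementeds (LMCongruence I A)

end Congruences

section DualSpace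

/-- The set `X(A)` of all prime filters of `A`. It carries the inclusion order. -/
abbrev DualSpace (A : Type v) [DistribLattice A] [BoundedOrder A] : Type v :=
  {P : PFilter A // P.IsPrime}

/-- `sigma a` is the set of the prime filters that contain `a`. -/
def sigma {A : Type v} [DistribLattice A] [BoundedOrder A] (a : A) : Set (DualSpace A) :=
  {P | a ∈ P.1}

/-- The topology with the sets `sigma a` and their complements as a subbasis. -/
instance (A : Type v) [DistribLattice A] [BoundedOrder A] : TopologicalSpace (DualSpace A) :=
  TopologicalSpace.generateFrom {U | ∃ a : A, U = sigma a ∨ U = (sigma a)ᶜ}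

/-- The inverse image of a prime filter under an endomorphism of bounded lattices. -/
def comapFilter {A : Type v} [DistribLattice A] [BoundedOrder A] (h : BoundedLatticeHom A A)
    (P : DualSpace A) : DualSpace A :=
  have hF : IsPFilter (h ⁻¹' (P.1 : Set A)) := by
    refine IsPFilter.of_def ⟨⊤, ?_⟩ ?_ ?_
    · simp
    · intro x hx y hy
      refine ⟨x ⊓ y, ?_, inf_le_left, inf_le_right⟩
      have : h x ⊓ h y ∈ P.1 := PFilter.inf_mem hx hy
      simpa using this
    · intro x y hxy hx
      exact PFilter.mem_of_le (OrderHomClass.mono h hxy) hx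
  ⟨hF.toPFilter, ⟨by
    obtain ⟨h1, h2, h3⟩ := P.2.compl_ideal
    change IsIdeal (h ⁻¹' (P.1 : Set A))ᶜ
    refine ⟨fun x y hxy hx => h1 (OrderHomClass.mono h hxy) hx, ⟨⊥, ?_⟩, ?_⟩
    · obtain ⟨z, hz⟩ := h2
      change h ⊥ ∈ (P.1 : Set A)ᶜ
      rw [map_bot]
      exact h1 bot_le hz
    · intro x hx y hy
      refine ⟨x ⊔ y, ?_, le_sup_left, le_sup_right⟩
      obtain ⟨z, hz, hxz, hyz⟩ := h3 (h x) hx (h y) hy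
      change h (x ⊔ y) ∈ (P.1 : Set A)ᶜ
      rw [map_sup]
      exact h1 (sup_le hxz hyz) hz⟩⟩

theorem mem_comapFilter {A : Type v} [DistribLattice A] [BoundedOrder A]
    (h : BoundedLatticeHom A A) (P : DualSpace A) (a : A) :
    a ∈ (comapFilter h P).1 ↔ h a ∈ P.1 := Iff.rfl

/-- The maps `f i` of the dual space, `f i P = (φ i)⁻¹(P)`. -/
def dualMap {I : Type u} [LinearOrder I] {A : Type v} [DistribLattice A] [BoundedOrder A]
    [LMAlgebra I A] (i : I) (P : DualSpace A) : DualSpace A :=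
  comapFilter (phi i) P

end DualSpace

section Subsets

/-- `Y` is semimodal for the family `f`: the union of the images `f i (Y)` is contained in `Y`. -/
def IsSemimodal {I : Type u} {X : Type v} (f : I → X → X) (Y : Set X) : Prop :=
  ⋃ i, f i '' Y ⊆ Y

/-- `Y` is modal for the family `f`: `Y` is its own inverse image under each `f i`. -/
def IsModal {I : Type u} {X : Type v} (f : I → X → X) (Y : Set X) : Prop :=
  ∀ i, Y = f i ⁻¹' Y

variable (I : Type u) [LinearOrder I] (A : Type v) [DistribLattice A] [BoundedOrder A]
  [LMAlgebra I A]

/-- The closed semimodal subsets of the dual space: the domain of `thetaS`. -/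
def closedSemimodal : Set (Set (DualSpace A)) :=
  {Y | IsClosed Y ∧ IsSemimodal (dualMap (I := I)) Y}

/-- The open subsets of the dual space with semimodal complement: the domain of `thetaOS`. -/
def openCosemimodal : Set (Set (DualSpace A)) :=
  {G | IsOpen G ∧ IsSemimodal (dualMap (I := I)) Gᶜ}

/-- The Boolean lattice of the closed, open and modal subsets of the dual space, with the
set-theoretic operations. -/
def clopenModal : BooleanSubalgebra (Set (DualSpace A)) where
  carrier := {G | IsClosed G ∧ IsOpen G ∧ IsModal (dualMap (I := I)) G}
  supClosed' := by
    rintro G ⟨h1, h2, h3⟩ H ⟨k1, k2, k3⟩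
    refine ⟨h1.union k1, h2.union k2, fun i => ?_⟩
    change G ∪ H = dualMap i ⁻¹' (G ∪ H)
    rw [preimage_union, ← h3 i, ← k3 i]
  infClosed' := by
    rintro G ⟨h1, h2, h3⟩ H ⟨k1, k2, k3⟩
    refine ⟨h1.inter k1, h2.inter k2, fun i => ?_⟩
    change G ∩ H = dualMap i ⁻¹' (G ∩ H)
    rw [preimage_inter, ← h3 i, ← k3 i]
  compl_mem' := by
    rintro G ⟨h1, h2, h3⟩
    refine ⟨h2.isClosed_compl, h1.isOpen_compl, fun i => ?_⟩
    rw [preimage_compl, ← h3 i]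
  bot_mem' := ⟨isClosed_empty, isOpen_empty, fun _ => rfl⟩

variable {A}

/-- The set of pairs `(a, b)` for which `sigma a` and `sigma b` have the same trace on `Y`. -/
def thetaS (Y : Set (DualSpace A)) : Set (A × A) :=
  {p | sigma p.1 ∩ Y = sigma p.2 ∩ Y}

/-- The set of pairs `(a, b)` for which the symmetric difference of `sigma b` and `sigma a` is
contained in `G`. -/
def thetaOS (G : Set (DualSpace A)) : Set (A × A) :=
  {p | symmDiff (sigma p.2) (sigma p.1) ⊆ G}

end Subsets

end LM

namespace LM

open LMAlgebra

/-! ### Separation by prime filters and the basis of the dual topology -/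

section PrimeFilters

variable {A : Type*} [DistribLattice A] [BoundedOrder A]

/-! Both correspondences pass through the elements `c` of `A` fixed by every `phi i`. Such a `c` is
complemented, and `sigma c` is clopen and modal. Conversely, every clopen modal set has this form
(`exists_eq_sigma`): modality lets complemented elements separate the set from each point outside
it, and the prime filter theorem plays the role of compactness.

On the side of congruences, `thetaOS (sigma c)` is the relation `a ⊔ c = b ⊔ c`
(`mem_thetaOS_sigma`), and the congruence given by the trace on `sigma c` is its complement.
Conversely, let `s` and `t` be complementary congruences. They join `⊥` to `⊤`, and
`exists_bot_rel_of_sup_rel` shortens the connecting chain to a single intermediate element `d`, with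
`⊥` and `d` related by `s`, `d` and `⊤` by `t`. Then `c = phi i d` is fixed by all the operations
`phi j` and determines `s` (`exists_pairs_eq_thetaOS_sigma`).

Finally `thetaOS G = thetaS Gᶜ`, so composing with complementation gives the dual isomorphism. -/

theorem mem_sigma {a : A} {P : DualSpace A} : P ∈ sigma a ↔ a ∈ P.1 := Iff.rfl

theorem DualSpace.sup_mem_iff (P : DualSpace A) {a b : A} :
    a ⊔ b ∈ P.1 ↔ a ∈ P.1 ∨ b ∈ P.1 := by
  refine ⟨fun h => ?_, fun h => h.elim (PFilter.mem_of_le le_sup_left)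
    (PFilter.mem_of_le le_sup_right)⟩
  by_contra! hab
  exact Ideal.sup_mem (s := P.2.compl_ideal.toIdeal) (x := a) (y := b) hab.1 hab.2 h

theorem DualSpace.bot_notMem (P : DualSpace A) : ⊥ ∉ P.1 :=
  Ideal.bot_mem P.2.compl_ideal.toIdeal

theorem DualSpace.mem_iff_notMem_of_isCompl (P : DualSpace A) {a b : A} (h : IsCompl a b) :
    b ∈ P.1 ↔ a ∉ P.1 := by
  refine ⟨fun hb ha => P.bot_notMem ?_, fun ha => ?_⟩
  · rw [← h.inf_eq_bot]
    exact PFilter.inf_mem ha hb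
  · have : a ⊔ b ∈ P.1 := by
      rw [h.sup_eq_top]
      exact PFilter.top_mem
    exact (P.sup_mem_iff.1 this).resolve_left ha

theorem exists_dualSpace_of_disjoint {F : PFilter A} {J : Ideal A}
    (h : Disjoint (F : Set A) J) :
    ∃ P : DualSpace A, (∀ a ∈ F, a ∈ P.1) ∧ ∀ a ∈ J, a ∉ P.1 := by
  obtain ⟨K, hK, hJK, hFK⟩ := DistribLattice.prime_ideal_of_disjoint_filter_ideal h
  exact ⟨⟨hK.toPrimePair.F, hK.toPrimePair.F_isPrime⟩,
    fun a ha haK => Set.disjoint_left.1 hFK ha haK, fun a ha haP => haP (hJK ha)⟩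

theorem sigma_subset_sigma {a b : A} : sigma a ⊆ sigma b ↔ a ≤ b := by
  refine ⟨fun h => ?_, fun h P hP => PFilter.mem_of_le h hP⟩
  by_contra hab
  obtain ⟨P, hF, hJ⟩ := exists_dualSpace_of_disjoint
    (F := PFilter.principal a) (J := Ideal.principal b)
    (Set.disjoint_left.2 fun x hx hx' => hab (le_trans hx hx'))
  exact hJ b (Ideal.mem_principal_self) (h (hF a (PFilter.mem_principal.2 le_rfl)))

theorem sigma_injective : Function.Injective (sigma : A → Set (DualSpace A)) := fun _ _ h =>
  le_antisymm (sigma_subset_sigma.1 h.subset) (sigma_subset_sigma.1 h.symm.subset)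

theorem sigma_sup (a b : A) : sigma (a ⊔ b) = sigma a ∪ sigma b :=
  Set.ext fun P => P.sup_mem_iff

theorem sigma_inf (a b : A) : sigma (a ⊓ b) = sigma a ∩ sigma b :=
  Set.ext fun _ => PFilter.inf_mem_iff

theorem sigma_bot : sigma (⊥ : A) = ∅ :=
  Set.eq_empty_of_forall_notMem fun P => P.bot_notMem

theorem sigma_top : sigma (⊤ : A) = univ :=
  Set.eq_univ_of_forall fun _ => PFilter.top_mem

theorem isOpen_sigma (a : A) : IsOpen (sigma a) :=
  TopologicalSpace.isOpen_generateFrom_of_mem ⟨a, .inl rfl⟩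

theorem isClosed_sigma (a : A) : IsClosed (sigma a) :=
  ⟨TopologicalSpace.isOpen_generateFrom_of_mem ⟨a, .inr rfl⟩⟩

/-- The sets `sigma a \ sigma b` form a basis of the topology. -/
theorem exists_sigma_diff_subset {U : Set (DualSpace A)} (hU : IsOpen U) {P : DualSpace A}
    (hP : P ∈ U) : ∃ a b : A, a ∈ P.1 ∧ b ∉ P.1 ∧ sigma a \ sigma b ⊆ U := by
  induction hU with
  | basic s hs =>
    obtain ⟨a, rfl | rfl⟩ := hs
    · exact ⟨a, ⊥, hP, P.bot_notMem, Set.sdiff_subset⟩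
    · exact ⟨⊤, a, PFilter.top_mem, hP, fun _ h => h.2⟩
  | univ => exact ⟨⊤, ⊥, PFilter.top_mem, P.bot_notMem, Set.subset_univ _⟩
  | inter s t _ _ hs ht =>
    obtain ⟨a, b, ha, hb, hab⟩ := hs hP.1
    obtain ⟨c, d, hc, hd, hcd⟩ := ht hP.2
    refine ⟨a ⊓ c, b ⊔ d, PFilter.inf_mem ha hc, fun h => (P.sup_mem_iff.1 h).elim hb hd, ?_⟩
    rw [sigma_inf, sigma_sup]
    exact fun Q hQ => ⟨hab ⟨hQ.1.1, fun h => hQ.2 (.inl h)⟩, hcd ⟨hQ.1.2, fun h => hQ.2 (.inr h)⟩⟩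
  | sUnion S _ ih =>
    obtain ⟨s, hs, hPs⟩ := hP
    obtain ⟨a, b, ha, hb, hab⟩ := ih s hs hPs
    exact ⟨a, b, ha, hb, hab.trans (Set.subset_sUnion_of_mem hs)⟩

theorem thetaOS_eq_thetaS_compl (G : Set (DualSpace A)) : thetaOS G = thetaS Gᶜ := by
  ext ⟨a, b⟩
  simp only [thetaOS, thetaS, Set.mem_ofPred_eq, Set.subset_def, Set.ext_iff, Set.mem_symmDiff,
    Set.mem_inter_iff, Set.mem_compl_iff]
  refine forall_congr' fun P => ?_
  tauto

theorem mem_thetaS {Y : Set (DualSpace A)} {a b : A} :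
    (a, b) ∈ thetaS Y ↔ ∀ P ∈ Y, (a ∈ P.1 ↔ b ∈ P.1) := by
  simp only [thetaS, Set.mem_ofPred_eq, Set.ext_iff, Set.mem_inter_iff, mem_sigma,
    and_congr_left_iff]

/-- Both sides say that `a` and `b` lie in the same prime filters among those that omit `c`, since
every prime filter containing `c` contains both joins. -/
theorem mem_thetaOS_sigma {a b c : A} : (a, b) ∈ thetaOS (sigma c) ↔ a ⊔ c = b ⊔ c := by
  rw [thetaOS_eq_thetaS_compl, ← sigma_injective.eq_iff, sigma_sup, sigma_sup, mem_thetaS]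
  simp only [Set.ext_iff, Set.mem_compl_iff, Set.mem_union, mem_sigma]
  refine forall_congr' fun P => ?_
  tauto

end PrimeFilters

/-! ### Clopen modal sets are represented by elements -/

section ModalSets

variable {I : Type*} [LinearOrder I] {A : Type*} [DistribLattice A] [BoundedOrder A]
  [LMAlgebra I A]

theorem isCompl_phi_phiBar (i : I) (x : A) : IsCompl (phi i x) (phiBar i x) :=
  IsCompl.of_eq (phi_inf_phiBar i x) (phi_sup_phiBar i x)

theorem sigma_phi (i : I) (a : A) : sigma (phi i a) = dualMap i ⁻¹' sigma a := rfl

theorem IsModal.mem_iff {Y : Set (DualSpace A)} (hY : IsModal (dualMap (I := I)) Y) (i : I)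
    {P : DualSpace A} : dualMap i P ∈ Y ↔ P ∈ Y :=
  (Set.ext_iff.1 (hY i) P).symm

theorem IsModal.compl {Y : Set (DualSpace A)} (hY : IsModal (dualMap (I := I)) Y) :
    IsModal (dualMap (I := I)) Yᶜ := fun i => by
  rw [Set.preimage_compl, ← hY i]

theorem IsModal.isSemimodal {Y : Set (DualSpace A)} (hY : IsModal (dualMap (I := I)) Y) :
    IsSemimodal (dualMap (I := I)) Y :=
  Set.iUnion_subset fun i => Set.image_subset_iff.2 (hY i).subset

theorem IsSemimodal.dualMap_mem {Y : Set (DualSpace A)}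
    (hY : IsSemimodal (dualMap (I := I)) Y) (i : I) {P : DualSpace A} (hP : P ∈ Y) :
    dualMap i P ∈ Y :=
  hY (Set.mem_iUnion.2 ⟨i, P, hP, rfl⟩)

theorem isModal_sigma_iff {c : A} :
    IsModal (dualMap (I := I)) (sigma c) ↔ ∀ i : I, phi i c = c := by
  simp only [IsModal, ← sigma_phi, sigma_injective.eq_iff]
  exact forall_congr' fun i => eq_comm

variable [Nonempty I]

/-- A basic neighbourhood `sigma a \ sigma b` of `dualMap i P` inside `U` pulls back along `dualMap
i` to `sigma (phi i a ⊓ phiBar i b)`. Modality of `U` keeps the pullback inside `U`, and the element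
is complemented because `phi i a` and `phiBar i b` are. -/
theorem IsModal.exists_isCompl {U : Set (DualSpace A)} (hU : IsOpen U)
    (hM : IsModal (dualMap (I := I)) U) {P : DualSpace A} (hP : P ∈ U) :
    ∃ e e' : A, IsCompl e e' ∧ e ∈ P.1 ∧ sigma e ⊆ U := by
  obtain ⟨i⟩ := ‹Nonempty I›
  obtain ⟨a, b, ha, hb, hab⟩ := exists_sigma_diff_subset hU ((hM.mem_iff i).2 hP)
  have hdiff (Q : DualSpace A) : phi i a ⊓ phiBar i b ∈ Q.1 ↔
      dualMap i Q ∈ sigma a \ sigma b := by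
    rw [PFilter.inf_mem_iff, Q.mem_iff_notMem_of_isCompl (isCompl_phi_phiBar i b)]
    rfl
  exact ⟨_, _, (isCompl_phi_phiBar i a).inf_sup (isCompl_phi_phiBar i b).symm,
    (hdiff P).2 ⟨ha, hb⟩, fun Q hQ => (hM.mem_iff i).1 (hab ((hdiff Q).1 hQ))⟩

/-- A clopen modal set is `sigma c` for some `c`. -/
theorem exists_eq_sigma {G : Set (DualSpace A)} (hG : G ∈ clopenModal I A) :
    ∃ c : A, G = sigma c := by
  obtain ⟨hc, ho, hM⟩ := hG
  have hJ : IsIdeal {a : A | sigma a ⊆ G} :=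
    ⟨fun a b hba ha => (sigma_subset_sigma.2 hba).trans ha,
      ⟨⊥, by simp [sigma_bot]⟩,
      fun a ha b hb => ⟨a ⊔ b, by
        rw [Set.mem_ofPred_eq, sigma_sup]
        exact Set.union_subset ha hb, le_sup_left, le_sup_right⟩⟩
  have hF : IsPFilter {a : A | G ⊆ sigma a} :=
    IsPFilter.of_def ⟨⊤, by simp [sigma_top]⟩
      (fun a ha b hb => ⟨a ⊓ b, by
        rw [Set.mem_ofPred_eq, sigma_inf]
        exact Set.subset_inter ha hb, inf_le_left, inf_le_right⟩)
      fun hab ha => Set.Subset.trans ha (sigma_subset_sigma.2 hab)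
  -- A common element of the filter and the ideal is the required `c`. If there is none, a prime
  -- filter `P` separates them, and a complemented `e` in `P` with `sigma e` inside `G` or inside
  -- its complement gives a contradiction: `e` lies in the ideal in the first case, its complement
  -- `e'` in the filter in the second.
  by_cases hd : Disjoint (hF.toPFilter : Set A) hJ.toIdeal
  · obtain ⟨P, hFP, hJP⟩ := exists_dualSpace_of_disjoint hd
    exfalso
    by_cases hP : P ∈ G
    · obtain ⟨e, _, _, he, heG⟩ := hM.exists_isCompl ho hP
      exact hJP e heG he
    · obtain ⟨e, e', hee, he, heG⟩ := hM.compl.exists_isCompl hc.isOpen_compl hP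
      refine (P.mem_iff_notMem_of_isCompl hee).1 (hFP e' fun Q hQ => ?_) he
      exact (Q.mem_iff_notMem_of_isCompl hee).2 fun h => heG h hQ
  · obtain ⟨c, hc1, hc2⟩ := Set.not_disjoint_iff.1 hd
    exact ⟨c, Set.Subset.antisymm hc1 hc2⟩

end ModalSets

/-! ### Trace congruences and complemented congruences -/

section Congruences

variable {I : Type*} [LinearOrder I] {A : Type*} [DistribLattice A] [BoundedOrder A]
  [LMAlgebra I A]

/-- The congruence that identifies elements with the same trace on a semimodal set. -/
def traceCongruence (Y : Set (DualSpace A)) (hY : IsSemimodal (dualMap (I := I)) Y) :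
    LMCongruence I A where
  r a b := ∀ P ∈ Y, (a ∈ P.1 ↔ b ∈ P.1)
  iseqv := ⟨fun _ _ _ => Iff.rfl, fun h P hP => (h P hP).symm,
    fun h k P hP => (h P hP).trans (k P hP)⟩
  sup_compat h k P hP := by rw [P.sup_mem_iff, P.sup_mem_iff, h P hP, k P hP]
  inf_compat h k P hP := by rw [PFilter.inf_mem_iff, PFilter.inf_mem_iff, h P hP, k P hP]
  phi_compat i _ _ h P hP := h _ (hY.dualMap_mem i hP)
  phiBar_compat i a b h P hP := by
    rw [P.mem_iff_notMem_of_isCompl (isCompl_phi_phiBar i a),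
      P.mem_iff_notMem_of_isCompl (isCompl_phi_phiBar i b)]
    exact not_congr (h _ (hY.dualMap_mem i hP))

theorem pairs_traceCongruence (Y : Set (DualSpace A)) (hY : IsSemimodal (dualMap (I := I)) Y) :
    (traceCongruence Y hY).pairs = thetaS Y :=
  Set.ext fun _ => mem_thetaS.symm

theorem LMCongruence.pairs_injective :
    Function.Injective (LMCongruence.pairs : LMCongruence I A → Set (A × A)) := fun _ _ h =>
  le_antisymm (le_iff_pairs.2 h.subset) (le_iff_pairs.2 h.symm.subset)

theorem disjoint_traceCongruence_compl {Y : Set (DualSpace A)}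
    (hY : IsSemimodal (dualMap (I := I)) Y) (hY' : IsSemimodal (dualMap (I := I)) Yᶜ) :
    Disjoint (traceCongruence Y hY) (traceCongruence Yᶜ hY') := by
  rw [disjoint_iff_inf_le]
  rintro a b ⟨h, h'⟩
  refine sigma_injective (Set.ext fun P => ?_)
  by_cases hP : P ∈ Y
  exacts [h P hP, h' P hP]

theorem codisjoint_traceCongruence_sigma_compl {c : A}
    (h : IsSemimodal (dualMap (I := I)) (sigma c))
    (h' : IsSemimodal (dualMap (I := I)) (sigma c)ᶜ) :
    Codisjoint (traceCongruence (sigma c) h) (traceCongruence (sigma c)ᶜ h') := by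
  rw [codisjoint_iff_le_sup]
  -- `a` and `a ⊓ c` agree on `sigma c`, while `a ⊓ c` and `⊥` agree off it. Hence every element is
  -- joined to `⊥`.
  have key (a : A) : (traceCongruence (sigma c) h ⊔ traceCongruence (sigma c)ᶜ h').toSetoid a ⊥ :=
    Setoid.trans' _ (y := a ⊓ c)
      ((le_sup_left : traceCongruence (sigma c) h ≤ _) fun P (hP : c ∈ P.1) => by
        simp [PFilter.inf_mem_iff, hP])
      ((le_sup_right : traceCongruence (sigma c)ᶜ h' ≤ _) fun P (hP : c ∉ P.1) => by
        simp [PFilter.inf_mem_iff, hP, P.bot_notMem])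
  exact fun a b _ => Setoid.trans' _ (key a) (Setoid.symm' _ (key b))

/-- On the elements of the form `phi i x`, two congruences permute as far as the class of `⊥` is
concerned. -/
theorem exists_bot_rel_of_sup_rel (s t : LMCongruence I A) (i : I) {x : A}
    (h : (s ⊔ t).toSetoid ⊥ x) : ∃ c, s.toSetoid ⊥ c ∧ t.toSetoid c (phi i x) := by
  have step_s {x y : A} (hxy : s.toSetoid x y)
      (hx : ∃ c, s.toSetoid ⊥ c ∧ t.toSetoid c (phi i x)) :
      ∃ c, s.toSetoid ⊥ c ∧ t.toSetoid c (phi i y) := by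
    obtain ⟨c, hc, hcx⟩ := hx
    -- Modulo `s`, `c` becomes `⊥` and `phi i y` becomes `phi i x`, so the witness collapses to `phi
    -- i x ⊓ phiBar i x = ⊥`. Modulo `t`, `c` becomes `phi i x`, so the second factor becomes `⊤`
    -- and `phi i y` is left.
    refine ⟨phi i y ⊓ (c ⊔ phiBar i x), ?_, ?_⟩
    · have := s.inf_compat (s.phi_compat i hxy) (s.sup_compat hc (s.refl (phiBar i x)))
      rwa [bot_sup_eq, phi_inf_phiBar] at this
    · have := t.inf_compat (t.refl (phi i y)) (t.sup_compat hcx (t.refl (phiBar i x)))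
      rwa [phi_sup_phiBar, inf_top_eq] at this
  have step_t {x y : A} (hxy : t.toSetoid x y)
      (hx : ∃ c, s.toSetoid ⊥ c ∧ t.toSetoid c (phi i x)) :
      ∃ c, s.toSetoid ⊥ c ∧ t.toSetoid c (phi i y) :=
    let ⟨c, hc, hcx⟩ := hx
    ⟨c, hc, t.trans hcx (t.phi_compat i hxy)⟩
  have key {x y : A} (hxy : Relation.EqvGen (fun x y => s.toSetoid x y ∨ t.toSetoid x y) x y) :
      (∃ c, s.toSetoid ⊥ c ∧ t.toSetoid c (phi i x)) ↔
        ∃ c, s.toSetoid ⊥ c ∧ t.toSetoid c (phi i y) := by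
    induction hxy with
    | rel x y h =>
      exact h.elim (fun h => ⟨step_s h, step_s (s.symm h)⟩)
        fun h => ⟨step_t h, step_t (t.symm h)⟩
    | refl => rfl
    | symm _ _ _ ih => exact ih.symm
    | trans _ _ _ _ _ ih ih' => exact ih.trans ih'
  rw [LMCongruence.toSetoid_sup, Setoid.sup_eq_eqvGen] at h
  -- The existence statement is invariant along the whole chain, and at its start `⊥` the witness
  -- `⊥` works.
  refine (key h).1 ⟨⊥, s.refl ⊥, ?_⟩
  rw [map_bot]

variable [Nonempty I]

/-- A complemented congruence is determined by an element `c` fixed by all the `phi i`. -/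
theorem exists_pairs_eq_thetaOS_sigma {s : LMCongruence I A} (hs : IsComplemented s) :
    ∃ c : A, (∀ i : I, phi i c = c) ∧ s.pairs = thetaOS (sigma c) := by
  obtain ⟨t, hst⟩ := hs
  obtain ⟨i⟩ := ‹Nonempty I›
  have htop : (s ⊔ t).toSetoid ⊥ ⊤ := by
    rw [hst.sup_eq_top]
    trivial
  obtain ⟨d, hd, hdt⟩ := exists_bot_rel_of_sup_rel s t i htop
  have hc := s.phi_compat i hd
  have hct := t.phi_compat i hdt
  rw [map_bot] at hc
  rw [map_top, map_top] at hct
  -- Applying `phi i` to `d` keeps it related to `⊥` by `s` and to `⊤` by `t`, and makes it fixed by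
  -- every `phi j`.
  refine ⟨phi i d, fun j => phi_phi j i d, ?_⟩
  ext ⟨a, b⟩
  rw [mem_thetaOS_sigma]
  have hsup (x : A) : s.toSetoid x (x ⊔ phi i d) := by
    have := s.sup_compat (s.refl x) hc
    rwa [sup_bot_eq] at this
  have htopx (x : A) : t.toSetoid (x ⊔ phi i d) ⊤ := by
    have := t.sup_compat (t.refl x) hct
    rwa [sup_top_eq] at this
  constructor
  · intro hab
    -- Modulo `t` both joins are `⊤`, so a pair in `s` yields joins related by `s ⊓ t = ⊥`, that is,
    -- equal ones.
    have h : (s ⊓ t).toSetoid (a ⊔ phi i d) (b ⊔ phi i d) :=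
      ⟨s.sup_compat hab (s.refl _), t.trans (htopx a) (t.symm (htopx b))⟩
    rw [hst.inf_eq_bot] at h
    exact h
  · intro h
    have hb := hsup b
    rw [← h] at hb
    exact s.trans (hsup a) (s.symm hb)

theorem isComplemented_traceCongruence {G : Set (DualSpace A)} (hG : G ∈ clopenModal I A) :
    IsComplemented (traceCongruence Gᶜ hG.2.2.compl.isSemimodal) := by
  have hM := hG.2.2
  obtain ⟨c, rfl⟩ := exists_eq_sigma hG
  exact ⟨traceCongruence (sigma c) hM.isSemimodal,
    (disjoint_traceCongruence_compl _ _).symm, (codisjoint_traceCongruence_sigma_compl _ _).symm⟩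

/-- The single pair `(⊥, c)` recovers `G = sigma c`: it belongs to `thetaOS H` exactly when `sigma c
⊆ H`. -/
theorem thetaOS_subset_thetaOS_iff {G H : Set (DualSpace A)} (hG : G ∈ clopenModal I A) :
    thetaOS G ⊆ thetaOS H ↔ G ⊆ H := by
  refine ⟨fun h => ?_, fun h p hp => Set.Subset.trans hp h⟩
  obtain ⟨c, rfl⟩ := exists_eq_sigma hG
  have hc : (⊥, c) ∈ thetaOS H := h (mem_thetaOS_sigma.2 (by simp))
  rw [thetaOS, Set.mem_ofPred_eq, sigma_bot, ← Set.bot_eq_empty, symmDiff_bot] at hc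
  exact hc

variable (I A) in
/-- The lattice of clopen modal sets is isomorphic to the lattice of Boolean congruences. -/
noncomputable def clopenModalIso : clopenModal I A ≃o BooleanCongruence I A :=
  RelIso.ofSurjective
    (OrderEmbedding.ofMapLEIff
      (fun G => ⟨traceCongruence (G : Set (DualSpace A))ᶜ G.2.2.2.compl.isSemimodal,
        isComplemented_traceCongruence G.2⟩)
      fun G H => by
        rw [← Subtype.coe_le_coe, LMCongruence.le_iff_pairs, pairs_traceCongruence,
          pairs_traceCongruence, ← thetaOS_eq_thetaS_compl, ← thetaOS_eq_thetaS_compl]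
        exact thetaOS_subset_thetaOS_iff G.2)
    fun s => by
      obtain ⟨c, hc, hs⟩ := exists_pairs_eq_thetaOS_sigma s.2
      have hM := isModal_sigma_iff.2 hc
      refine ⟨⟨sigma c, isClosed_sigma c, isOpen_sigma c, hM⟩,
        Subtype.ext (LMCongruence.pairs_injective ?_)⟩
      rw [hs, thetaOS_eq_thetaS_compl]
      exact pairs_traceCongruence _ hM.compl.isSemimodal

theorem pairs_clopenModalIso (G : clopenModal I A) :
    (clopenModalIso I A G : LMCongruence I A).pairs = thetaOS (G : Set (DualSpace A)) :=
  (pairs_traceCongruence _ G.2.2.2.compl.isSemimodal).trans (thetaOS_eq_thetaS_compl _).symm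

end Congruences

end LM

theorem mainTheorem1 {I : Type*} [LinearOrder I] [Nonempty I]
    {A : Type*} [DistribLattice A] [BoundedOrder A] [LM.LMAlgebra I A] :
    (∀ G ∈ LM.clopenModal I A, G ∈ LM.openCosemimodal I A ∧ G ∈ LM.closedSemimodal I A) ∧
    (∃ thetaOM : LM.clopenModal I A ≃o LM.BooleanCongruence I A,
      ∀ G : LM.clopenModal I A,
        (thetaOM G : LM.LMCongruence I A).pairs = LM.thetaOS (G : Set (LM.DualSpace A))) ∧
    (∃ thetaCM : LM.clopenModal I A ≃o (LM.BooleanCongruence I A)ᵒᵈ,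
      ∀ G : LM.clopenModal I A,
        (OrderDual.ofDual (thetaCM G)).1.pairs =
          LM.thetaS (G : Set (LM.DualSpace A))) := by
  refine ⟨fun G hG => ⟨⟨hG.2.1, hG.2.2.compl.isSemimodal⟩, hG.1, hG.2.2.isSemimodal⟩,
    ⟨LM.clopenModalIso I A, LM.pairs_clopenModalIso⟩,
    -- As `thetaS G = thetaOS Gᶜ`, the second map is the first one preceded by the order-reversing
    -- complementation.
    ⟨(OrderIso.compl (LM.clopenModal I A)).trans (LM.clopenModalIso I A).dual, fun G => ?_⟩⟩
  refine (LM.pairs_clopenModalIso Gᶜ).trans ?_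
  rw [LM.thetaOS_eq_thetaS_compl, BooleanSubalgebra.val_compl, compl_compl]
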